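/- Let $\Omega\subset\mathbb R^D$ be a bounded open set and let $K:\Omega\times\Omega\to\mathbb R$ be an admissible kernel, that is, $K$ is bounded, continuous and symmetric, and for all distinct points $x^1,\dots,x^M\in\Omega$ the matrix $(K(x^m,x^n))_{m,n}$ is positive definite. Let $T_Ka=\int_\Omega K(\cdot,z)\,a(z)\,dz$ on $L^2(\Omega)$, and let $(\lambda_i,\zeta_i)_{i\ge1}$ be a Mercer eigen-decomposition of $K$: $\lambda_1\ge\lambda_2\ge\dots>0$, the $\zeta_i$ are continuous and orthonormal in $L^2(\Omega)$, $T_K\zeta_i=\lambda_i\zeta_i$, and $T_K$ vanishes on the orthogonal complement of $\{\zeta_i\}_{i\ge 1}$ in $L^2(\Omega)$ (when $T_K$ is injective, $(\zeta_i)$ is an orthonormal basis of $L^2(\Omega)$). Let $s>0$, $p\in[1,\infty)$ and $1/p+1/p'=1$ (so $p'=\infty$ if $p=1$, and $\ell^\infty$ norms are suprema). With $\langle\varphi,\zeta_i\rangle=\int_\Omega\varphi\,\zeta_i\,dx$, put, for $r\in\mathbb R$ and $q\in[1,\infty]$, $$\|\varphi\|_{\mathcal H_K^{r,q}(\Omega)}=\Big\|\big(\lambda_i^{-r/2}\langle\varphi,\zeta_i\rangle\big)_{i\ge1}\Big\|_{\ell^q}\in[0,\infty],$$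 and let $\mathcal H_K^{s,p}(\Omega)$ be the space of all $\varphi\in L^p(\Omega)$ that are represented by their Mercer series, $\varphi=\sum_i\langle\varphi,\zeta_i\rangle\zeta_i$ in $L^2(\Omega)$, and for which $\|\varphi\|_{\mathcal H_K^{s,p}(\Omega)}<\infty$. Let $N\ge1$, let $Y=(y^1,\dots,y^N)$ be any points of $\Omega$, and set $$E_K^{s,p'}(Y)=\Big\|\Big(\lambda_i^{s/2}\Big(\int_\Omega\zeta_i(x)\,dx-\frac1N\sum_{n=1}^N\zeta_i(y^n)\Big)\Big)_{i\ge1}\Big\|_{\ell^{p'}}\in[0,\infty].$$ 1. For every $\varphi\in\mathcal H_K^{s,p}(\Omega)$ whose values at the nodes are those of its Mercer series, $\varphi(y^n)=\lim_{m\to\infty}\sum_{i\le m}\langle\varphi,\zeta_i\rangle\zeta_i(y^n)$ for $1\le n\le N$, one has $$\Big|\int_\Omega\varphi(x)\,dx-\frac1N\sum_{n=1}^N\varphi(y^n)\Big|\le E_K^{s,p'}(Y)\,\|\varphi\|_{\mathcal H_K^{s,p}(\Omega)}\qquad(\text{with }\infty\cdot0=0).$$ 2. The same inequality holds, without this condition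 on the nodes, for every $\varphi\in\mathcal H_K^{s,p}(\Omega)$ that is continuous on $\Omega$, provided that either $s\ge1$ and $p\le2$ (which includes the reproducing kernel Hilbert space, $s=1$, $p=2$), or each node $y^n$ has a neighbourhood on which $x\mapsto\big\|(\lambda_i^{s/2}\zeta_i(x))_{i\ge1}\big\|_{\ell^{p'}}$ is bounded. 3. With $e_K(Y)=\int_\Omega K(\cdot,z)\,dz-\frac1N\sum_{n=1}^NK(\cdot,y^n)$, one has $$E_K^{s,p'}(Y)=\|e_K(Y)\|_{\mathcal H_K^{2-s,p'}(\Omega)},$$ and so, for $s=1$, $E_K^{1,p'}(Y)=\|e_K(Y)\|_{\mathcal H_K^{1,p'}(\Omega)}$. -/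

import Mathlib

open Set Filter Topology MeasureTheory
open scoped ENNReal NNReal

noncomputable section

/-- Admissible kernels on a set `Ω` of `ℝ^D`: bounded, continuous, symmetric, and with positive
definite matrices `K(Y,Y)` for all finite families of distinct points. Only the values of `K` on
`Ω × Ω` matter. -/
structure IsAdmissibleKernel {D : ℕ} (Ω : Set (EuclideanSpace ℝ (Fin D)))
    (K : EuclideanSpace ℝ (Fin D) → EuclideanSpace ℝ (Fin D) → ℝ) : Prop where
  continuousOn : ContinuousOn (fun z : EuclideanSpace ℝ (Fin D) × EuclideanSpace ℝ (Fin D) =>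
    K z.1 z.2) (Ω ×ˢ Ω)
  bounded : ∃ C : ℝ, ∀ x ∈ Ω, ∀ z ∈ Ω, |K x z| ≤ C
  symm : ∀ x ∈ Ω, ∀ z ∈ Ω, K x z = K z x
  posDef : ∀ (N : ℕ) (y : Fin N → EuclideanSpace ℝ (Fin D)), Function.Injective y →
    (∀ n, y n ∈ Ω) → ∀ a : Fin N → ℝ, a ≠ 0 →
      0 < ∑ m, ∑ n, a m * a n * K (y m) (y n)

/-- The integral operator `T_K a = ∫_Ω K(·, z) a(z) dz`. -/
def kernelOp {D : ℕ} (Ω : Set (EuclideanSpace ℝ (Fin D)))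
    (K : EuclideanSpace ℝ (Fin D) → EuclideanSpace ℝ (Fin D) → ℝ)
    (a : EuclideanSpace ℝ (Fin D) → ℝ) (x : EuclideanSpace ℝ (Fin D)) : ℝ :=
  ∫ z in Ω, K x z * a z

/-- The `L²(Ω)` pairing of two real functions. -/
def pairing {D : ℕ} (Ω : Set (EuclideanSpace ℝ (Fin D)))
    (f g : EuclideanSpace ℝ (Fin D) → ℝ) : ℝ :=
  ∫ x in Ω, f x * g x

/-- `(lam i, ζ i)` is a Mercer eigen-decomposition of `T_K`: the non-increasing sequence of its
positive eigenvalues, with continuous, `L²(Ω)`-orthonormal eigenfunctions that exhaust the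
spectral decomposition (what is orthogonal to all of them is in the kernel of `T_K`; in
particular, they are an orthonormal basis of `L²(Ω)` when `T_K` is injective). -/
structure IsMercerDecomposition {D : ℕ} (Ω : Set (EuclideanSpace ℝ (Fin D)))
    (K : EuclideanSpace ℝ (Fin D) → EuclideanSpace ℝ (Fin D) → ℝ)
    (lam : ℕ → ℝ) (ζ : ℕ → EuclideanSpace ℝ (Fin D) → ℝ) : Prop where
  pos : ∀ i, 0 < lam i
  antitone : Antitone lam
  continuousOn : ∀ i, ContinuousOn (ζ i) Ω
  memLp : ∀ i, MemLp (ζ i) 2 (volume.restrict Ω)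
  orthonormal : ∀ i j, pairing Ω (ζ i) (ζ j) = if i = j then 1 else 0
  eigen : ∀ i, ∀ x ∈ Ω, kernelOp Ω K (ζ i) x = lam i * ζ i x
  exhaustive : ∀ g : EuclideanSpace ℝ (Fin D) → ℝ, MemLp g 2 (volume.restrict Ω) →
    (∀ i, pairing Ω g (ζ i) = 0) → ∀ x ∈ Ω, kernelOp Ω K g x = 0

/-- The `ℓ^q` norm, possibly infinite, of a real sequence, for `q ∈ [1, ∞]`. -/
def seqNorm (q : ℝ≥0∞) (a : ℕ → ℝ) : ℝ≥0∞ :=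
  eLpNorm a q Measure.count

theorem seqNorm_eq_tsum {q : ℝ≥0∞} (h0 : q ≠ 0) (htop : q ≠ ∞) (a : ℕ → ℝ) :
    seqNorm q a = (∑' i, ENNReal.ofReal |a i| ^ q.toReal) ^ (1 / q.toReal) := by
  rw [seqNorm, eLpNorm_eq_lintegral_rpow_enorm_toReal h0 htop, lintegral_count]
  simp only [← Real.norm_eq_abs, ofReal_norm]

theorem seqNorm_top (a : ℕ → ℝ) : seqNorm ∞ a = ⨆ i, ENNReal.ofReal |a i| := by
  rw [seqNorm, eLpNorm_exponent_top, eLpNormEssSup_eq_essSup_enorm, essSup_count]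
  simp only [← Real.norm_eq_abs, ofReal_norm]

/-- Partial sums `∑_{i < m} ⟨φ, ζ_i⟩ ζ_i(x)` of the Mercer representation of `φ`. -/
def mercerSum {D : ℕ} (Ω : Set (EuclideanSpace ℝ (Fin D)))
    (ζ : ℕ → EuclideanSpace ℝ (Fin D) → ℝ) (φ : EuclideanSpace ℝ (Fin D) → ℝ)
    (m : ℕ) (x : EuclideanSpace ℝ (Fin D)) : ℝ :=
  ∑ i ∈ Finset.range m, pairing Ω φ (ζ i) * ζ i x

/-- The norm `‖φ‖_{H_K^{s,p}(Ω)} = (∑_i lam_i^{-ps/2} |⟨φ, ζ_i⟩|^p)^{1/p}`, possibly infinite. -/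
def mercerNorm {D : ℕ} (Ω : Set (EuclideanSpace ℝ (Fin D))) (lam : ℕ → ℝ)
    (ζ : ℕ → EuclideanSpace ℝ (Fin D) → ℝ) (s : ℝ) (p : ℝ≥0∞)
    (φ : EuclideanSpace ℝ (Fin D) → ℝ) : ℝ≥0∞ :=
  seqNorm p (fun i => lam i ^ (-s / 2) * pairing Ω φ (ζ i))

/-- Membership in the space `H_K^{s,p}(Ω)`, a property of the class of `φ` modulo equality almost
everywhere in `Ω`: `φ` is in `L^p(Ω)`, is represented by its Mercer series in `L²(Ω)`, and has
finite norm. The second condition holds for all `φ` in `L²(Ω)` when the `ζ_i` are an orthonormal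
basis of `L²(Ω)`. -/
structure MemMercerSpace {D : ℕ} (Ω : Set (EuclideanSpace ℝ (Fin D))) (lam : ℕ → ℝ)
    (ζ : ℕ → EuclideanSpace ℝ (Fin D) → ℝ) (s : ℝ) (p : ℝ≥0∞)
    (φ : EuclideanSpace ℝ (Fin D) → ℝ) : Prop where
  memLp : MemLp φ p (volume.restrict Ω)
  mercer : Tendsto (fun m => eLpNorm (fun x => φ x - mercerSum Ω ζ φ m x) 2 (volume.restrict Ω))
    atTop (𝓝 0)
  norm_lt_top : mercerNorm Ω lam ζ s p φ < ∞

/-- The quadrature error `∫_Ω f - (1/N) ∑_n f(y^n)`. -/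
def quadError {D : ℕ} (Ω : Set (EuclideanSpace ℝ (Fin D))) {N : ℕ}
    (y : Fin N → EuclideanSpace ℝ (Fin D)) (f : EuclideanSpace ℝ (Fin D) → ℝ) : ℝ :=
  (∫ x in Ω, f x) - (1 / (N : ℝ)) * ∑ n, f (y n)

/-- The error function `E_K^{s,q}(Y)`: the `ℓ^q` norm of
`lam_i^{s/2} (∫_Ω ζ_i - (1/N) ∑_n ζ_i(y^n))`, possibly infinite. -/
def spectralError {D : ℕ} (Ω : Set (EuclideanSpace ℝ (Fin D))) (lam : ℕ → ℝ)
    (ζ : ℕ → EuclideanSpace ℝ (Fin D) → ℝ) (s : ℝ) (q : ℝ≥0∞) {N : ℕ}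
    (y : Fin N → EuclideanSpace ℝ (Fin D)) : ℝ≥0∞ :=
  seqNorm q (fun i => lam i ^ (s / 2) * quadError Ω y (ζ i))

/-- The function `e_K(Y) = ∫_Ω K(·, z) dz - (1/N) ∑_n K(·, y^n)`. -/
def errorFunction {D : ℕ} (Ω : Set (EuclideanSpace ℝ (Fin D)))
    (K : EuclideanSpace ℝ (Fin D) → EuclideanSpace ℝ (Fin D) → ℝ) {N : ℕ}
    (y : Fin N → EuclideanSpace ℝ (Fin D)) (x : EuclideanSpace ℝ (Fin D)) : ℝ :=
  quadError Ω y (K x)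

end

/-!
The error bounds are a duality between sequences: along the partial sums of the Mercer series, the
quadrature error of `φ` is `∑ ⟨φ, ζ i⟩ * quadError (ζ i)`, and Hölder's inequality with the weights
`lam i ^ (-s / 2)` and `lam i ^ (s / 2)` bounds it by the product of the two norms
(`ofReal_abs_sum_mul_le_seqNorm`). The integrals pass to the limit because `L²` convergence on the
bounded set `Ω` implies `L¹` convergence. The values at the nodes pass to the limit by hypothesis in
the first bound (`quadError_le_of_tendsto_mercerSum`).

In the second bound, they do so because a local bound on point evaluation makes the Mercer series
locally uniformly convergent (`tendsto_mercerSum_of_locally_bounded`). When `1 ≤ s` and `p ≤ 2`, the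
function `φ` has finite norm in the reproducing kernel Hilbert space, where that bound is
`∑ lam i * ζ i x ^ 2 ≤ K x x` (`IsMercerDecomposition.sum_le_diagonal`), which is Bessel's inequality
in a Hilbert space in which `K` is a Gram matrix. Since `Ω` is open rather than compact, Mercer's
theorem itself is not used.

The formula for the error function holds coefficient by coefficient, by Fubini's theorem
(`pairing_errorFunction`).
-/

section

variable {D : ℕ} {Ω : Set (EuclideanSpace ℝ (Fin D))}
    {K : EuclideanSpace ℝ (Fin D) → EuclideanSpace ℝ (Fin D) → ℝ}
    {lam : ℕ → ℝ} {ζ : ℕ → EuclideanSpace ℝ (Fin D) → ℝ}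
    {φ : EuclideanSpace ℝ (Fin D) → ℝ}

/-! ### Sequence norms -/

/-- Hölder's inequality for sequences, valid also when one factor is `∞` and the other is `0`. -/
theorem ofReal_abs_sum_mul_le_seqNorm {p q : ℝ≥0∞} (hpq : p⁻¹ + q⁻¹ = 1) (a b : ℕ → ℝ)
    (F : Finset ℕ) :
    ENNReal.ofReal |∑ i ∈ F, a i * b i| ≤ seqNorm q b * seqNorm p a := by
  have : ENNReal.HolderTriple q p 1 := ⟨by rw [add_comm, hpq, inv_one]⟩
  have h := eLpNorm_smul_le_mul_eLpNorm (p := q) (q := p) (r := 1) (μ := Measure.count)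
    (f := a) (φ := b) (by fun_prop) (by fun_prop)
  refine le_trans ?_ h
  rw [eLpNorm_one_eq_lintegral_enorm, lintegral_count]
  calc ENNReal.ofReal |∑ i ∈ F, a i * b i| = ‖∑ i ∈ F, a i * b i‖ₑ := by
        rw [← Real.norm_eq_abs, ofReal_norm]
    _ ≤ ∑ i ∈ F, ‖a i * b i‖ₑ := enorm_sum_le _ _
    _ = ∑ i ∈ F, ‖(b • a) i‖ₑ := by simp [mul_comm]
    _ ≤ _ := ENNReal.sum_le_tsum F

theorem tendsto_seqNorm_tail {p : ℝ≥0∞} (hp : p ≠ 0) (hp_top : p ≠ ∞) {a : ℕ → ℝ}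
    (ha : seqNorm p a < ∞) :
    Tendsto (fun m => seqNorm p (indicator (Ici m) a)) atTop (𝓝 0) := by
  have hp' : 0 < p.toReal := ENNReal.toReal_pos hp hp_top
  simp_rw [seqNorm_eq_tsum hp hp_top] at ha ⊢
  have hfin : ∑' i, ENNReal.ofReal |a i| ^ p.toReal ≠ ∞ := by
    intro h
    rw [h, ENNReal.top_rpow_of_pos (by positivity)] at ha
    exact lt_irrefl _ ha
  have h := (ENNReal.tendsto_tsum_compl_atTop_zero hfin).comp tendsto_finset_range
  have h2 := h.ennrpow_const (1 / p.toReal)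
  rw [ENNReal.zero_rpow_of_pos (by positivity)] at h2
  refine h2.congr fun m => ?_
  simp only [Function.comp]
  congr 1
  rw [show (∑' b : {x // x ∉ Finset.range m}, ENNReal.ofReal |a b| ^ p.toReal)
    = ∑' b : (Ici m : Set ℕ), ENNReal.ofReal |a b| ^ p.toReal from
      (Equiv.subtypeEquivRight (by simp)).tsum_eq
        (fun b : (Ici m : Set ℕ) => ENNReal.ofReal |a b| ^ p.toReal),
    tsum_subtype (Ici m) fun i => ENNReal.ofReal |a i| ^ p.toReal]
  refine tsum_congr fun i => ?_
  by_cases hi : i ∈ Ici m <;> simp [hi, hp']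

/-- The bridge to `Memℓp`, whose monotonicity in the exponent is in Mathlib. -/
theorem seqNorm_lt_top_iff_memℓp {p : ℝ≥0∞} (hp : p ≠ 0) (hp_top : p ≠ ∞) (a : ℕ → ℝ) :
    seqNorm p a < ∞ ↔ Memℓp a p := by
  have hp' : 0 < p.toReal := ENNReal.toReal_pos hp hp_top
  rw [memℓp_gen_iff hp', seqNorm_eq_tsum hp hp_top, ENNReal.rpow_lt_top_iff_of_pos (by positivity)]
  simp_rw [ENNReal.ofReal_rpow_of_nonneg (abs_nonneg _) hp'.le, Real.norm_eq_abs]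
  refine ⟨fun h => ?_, fun h => h.tsum_ofReal_lt_top⟩
  refine (ENNReal.summable_toReal h.ne).congr fun i => ?_
  rw [ENNReal.toReal_ofReal (by positivity)]

theorem seqNorm_mono {p : ℝ≥0∞} {a b : ℕ → ℝ} (h : ∀ i, |a i| ≤ |b i|) :
    seqNorm p a ≤ seqNorm p b :=
  eLpNorm_mono fun i => by simpa using h i

/-! ### Feature maps of admissible kernels -/

/-- A real symmetric positive semidefinite kernel is a Gram matrix in some Hilbert space: Moore's
theorem in the scalar case, the scalar `k x z` being read as the operator `k x z • id` on `ℝ`. -/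
theorem exists_inner_eq_of_posSemidef {X : Type} (k : X → X → ℝ) (hsymm : ∀ x z, k x z = k z x)
    (hpos : ∀ v : X →₀ ℝ, 0 ≤ v.sum fun x a => v.sum fun z b => a * b * k x z) :
    ∃ (H : Type) (_ : NormedAddCommGroup H) (_ : InnerProductSpace ℝ H) (_ : CompleteSpace H)
      (Φ : X → H), ∀ x z, inner ℝ (Φ x) (Φ z) = k x z := by
  let A : Matrix X X (ℝ →L[ℝ] ℝ) := .of fun x z => k x z • ContinuousLinearMap.id ℝ ℝ
  have hA : A.PosSemidef := by
    have h := (RKHS.posSemidef_tfae (K := A)).out 0 2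
    refine h.mpr ⟨?_, fun v => ?_⟩
    · ext x z
      simp [A, hsymm x z, star, ContinuousLinearMap.adjoint_id]
    · refine (hpos v).trans_eq ?_
      simp only [Finsupp.sum, A, Matrix.of_apply, RCLike.re_to_real]
      refine Finset.sum_congr rfl fun x _ => Finset.sum_congr rfl fun z _ => ?_
      simp [hsymm x z]
      ring
  have : Fact A.PosSemidef := ⟨hA⟩
  refine ⟨RKHS.OfKernel A, inferInstance, inferInstance, inferInstance,
    fun x => RKHS.kerFun (RKHS.OfKernel A) x 1, fun x z => ?_⟩
  rw [← RKHS.kernel_inner, RKHS.OfKernel.kernel_ofKernel]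
  simp [A, hsymm x z]

/-- The points of a finitely supported function are distinct, so positive definiteness on distinct
points is all that semidefiniteness of the kernel requires. -/
theorem IsAdmissibleKernel.finsupp_sum_nonneg (hK : IsAdmissibleKernel Ω K) (v : Ω →₀ ℝ) :
    0 ≤ v.sum fun x a => v.sum fun z b => a * b * K x z := by
  by_cases hv : v = 0
  · simp [hv]
  let e := v.support.equivFin.symm
  have h := hK.posDef v.support.card (fun n => (e n : Ω))
    (fun a b hab => e.injective (Subtype.ext (Subtype.ext hab))) (fun n => (e n : Ω).2)
    (fun n => v (e n)) (by
      obtain ⟨x, hx⟩ := Finsupp.support_nonempty_iff.mpr hv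
      intro h0
      have := congrFun h0 (e.symm ⟨x, hx⟩)
      simp at this hx
      exact hx this)
  refine h.le.trans_eq ?_
  simp only [Finsupp.sum]
  rw [← Finset.sum_coe_sort v.support, ← e.sum_comp]
  refine Finset.sum_congr rfl fun m _ => ?_
  rw [← Finset.sum_coe_sort v.support, ← e.sum_comp]

/-- An admissible kernel has a feature map, continuous on `Ω` because
`‖Φ x - Φ a‖² = K x x - 2 K x a + K a a`. -/
theorem IsAdmissibleKernel.exists_featureMap (hK : IsAdmissibleKernel Ω K) :
    ∃ (H : Type) (_ : NormedAddCommGroup H) (_ : InnerProductSpace ℝ H) (_ : CompleteSpace H)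
      (Φ : EuclideanSpace ℝ (Fin D) → H), ContinuousOn Φ Ω ∧
        ∀ x ∈ Ω, ∀ z ∈ Ω, inner ℝ (Φ x) (Φ z) = K x z := by
  classical
  obtain ⟨H, _, _, _, Ψ, hΨ⟩ := exists_inner_eq_of_posSemidef (fun x z : Ω => K x z)
    (fun x z => hK.symm x x.2 z z.2) hK.finsupp_sum_nonneg
  refine ⟨H, inferInstance, inferInstance, inferInstance,
    fun x => if hx : x ∈ Ω then Ψ ⟨x, hx⟩ else 0, ?_, ?_⟩
  · rw [continuousOn_iff_continuous_domRestrict]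
    have hr : Ω.domRestrict (fun x => if hx : x ∈ Ω then Ψ ⟨x, hx⟩ else 0) = Ψ := by
      ext x; simp [domRestrict]
    rw [hr, continuous_iff_continuousAt]
    intro a
    have hKc : Continuous fun z : Ω × Ω => K z.1 z.2 :=
      hK.continuousOn.comp_continuous
        (f := fun z : Ω × Ω => ((z.1 : EuclideanSpace ℝ (Fin D)), (z.2 : EuclideanSpace ℝ (Fin D))))
        (by fun_prop) fun z => ⟨z.1.2, z.2.2⟩
    have hnorm : ∀ x, ‖Ψ x - Ψ a‖ = √(K x x - 2 * K x a + K a a) := fun x => by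
      rw [← Real.sqrt_sq (norm_nonneg _), norm_sub_sq_real, ← real_inner_self_eq_norm_sq,
        ← real_inner_self_eq_norm_sq, hΨ, hΨ, hΨ]
    rw [ContinuousAt, tendsto_iff_norm_sub_tendsto_zero]
    simp_rw [hnorm]
    have hc : Continuous fun x : Ω => √(K x x - 2 * K x a + K a a) := by
      have h1 : Continuous fun x : Ω => K x x := hKc.comp (continuous_id.prodMk continuous_id)
      have h2 : Continuous fun x : Ω => K x a := hKc.comp (continuous_id.prodMk continuous_const)
      exact ((h1.sub (h2.const_mul 2)).add continuous_const).sqrt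
    convert hc.tendsto a using 2
    rw [show K a a - 2 * K a a + K a a = 0 by ring, Real.sqrt_zero]
  · intro x hx z hz
    simp [hx, hz, hΨ]

/-! ### Bessel's inequality for the eigenfunctions -/

theorem isFiniteMeasure_restrict_of_isBounded (hΩb : Bornology.IsBounded Ω) :
    IsFiniteMeasure (volume.restrict Ω) :=
  ⟨by simpa using hΩb.measure_lt_top⟩

theorem IsMercerDecomposition.integrable (hΩb : Bornology.IsBounded Ω)
    (hM : IsMercerDecomposition Ω K lam ζ) (i : ℕ) : Integrable (ζ i) (volume.restrict Ω) :=
  have := isFiniteMeasure_restrict_of_isBounded hΩb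
  (hM.memLp i).integrable one_le_two

theorem IsMercerDecomposition.rpow_neg_half_mul_rpow_half (hM : IsMercerDecomposition Ω K lam ζ)
    (s : ℝ) (i : ℕ) : lam i ^ (-s / 2) * lam i ^ (s / 2) = 1 := by
  rw [← Real.rpow_add (hM.pos i), show -s / 2 + s / 2 = 0 by ring, Real.rpow_zero]

/-- The half of Mercer's theorem that needs no compactness: with a feature map `Φ`, the vectors
`lam i ^ (-1/2) • ∫ ζ i • Φ` are orthonormal and their inner products with `Φ x` are
`lam i ^ (1/2) * ζ i x`, so this is Bessel's inequality for `Φ x`. -/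
theorem IsMercerDecomposition.sum_le_diagonal (hΩ : IsOpen Ω) (hΩb : Bornology.IsBounded Ω)
    (hK : IsAdmissibleKernel Ω K) (hM : IsMercerDecomposition Ω K lam ζ)
    (F : Finset ℕ) {x : EuclideanSpace ℝ (Fin D)} (hx : x ∈ Ω) :
    ∑ i ∈ F, lam i * ζ i x ^ 2 ≤ K x x := by
  obtain ⟨H, _, _, _, Φ, hΦc, hΦ⟩ := hK.exists_featureMap
  obtain ⟨C, hC⟩ := hK.bounded
  have hint : ∀ i, Integrable (fun z => ζ i z • Φ z) (volume.restrict Ω) := fun i => by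
    refine (hM.integrable hΩb i).smul_bdd √C
      (hΦc.aestronglyMeasurable hΩ.measurableSet) ?_
    filter_upwards [ae_restrict_mem hΩ.measurableSet] with z hz
    rw [← Real.sqrt_sq (norm_nonneg _), ← real_inner_self_eq_norm_sq, hΦ z hz z hz]
    exact Real.sqrt_le_sqrt ((le_abs_self _).trans (hC z hz z hz))
  let w : ℕ → H := fun i => ∫ z in Ω, ζ i z • Φ z
  have hw : ∀ i, ∀ x ∈ Ω, inner ℝ (Φ x) (w i) = lam i * ζ i x := fun i x hx => by
    rw [← hM.eigen i x hx, kernelOp, ← integral_inner (hint i)]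
    refine setIntegral_congr_fun hΩ.measurableSet fun z hz => ?_
    simp only [inner_smul_right, hΦ x hx z hz, mul_comm]
  have hww : ∀ i j, inner ℝ (w j) (w i) = if i = j then lam j else 0 := fun i j => by
    rw [← integral_inner (hint i)]
    have : ∫ z in Ω, inner ℝ (w j) (ζ i z • Φ z) = ∫ z in Ω, lam j * (ζ i z * ζ j z) := by
      refine setIntegral_congr_fun hΩ.measurableSet fun z hz => ?_
      simp only [inner_smul_right, real_inner_comm, hw j z hz]
      ring
    have ho := hM.orthonormal i j
    rw [pairing] at ho
    rw [this, integral_const_mul, ho]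
    simp
  let u : ℕ → H := fun i => (√(lam i))⁻¹ • w i
  have hs : ∀ i, √(lam i) ≠ 0 := fun i => (Real.sqrt_pos.mpr (hM.pos i)).ne'
  have hu : Orthonormal ℝ u := by
    rw [orthonormal_iff_ite]
    intro i j
    simp only [u, inner_smul_left, inner_smul_right, hww]
    by_cases h : i = j
    · subst h
      have h2 := Real.mul_self_sqrt (hM.pos i).le
      have := hs i
      simp only [RCLike.conj_to_real, if_true]
      field_simp
      nlinarith
    · simp [h, Ne.symm h]
  calc ∑ i ∈ F, lam i * ζ i x ^ 2 = ∑ i ∈ F, ‖inner ℝ (u i) (Φ x)‖ ^ 2 := by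
        refine Finset.sum_congr rfl fun i _ => ?_
        simp only [u, inner_smul_left, real_inner_comm, hw i x hx]
        have h2 := Real.sq_sqrt (hM.pos i).le
        have := hs i
        simp only [RCLike.conj_to_real, Real.norm_eq_abs, sq_abs, mul_pow, inv_pow, h2]
        have := (hM.pos i).ne'
        field_simp
    _ ≤ ‖Φ x‖ ^ 2 := hu.sum_inner_products_le _
    _ = K x x := by rw [← real_inner_self_eq_norm_sq, hΦ x hx x hx]

/-! ### The error function -/

/-- Fubini's theorem and the symmetry of `K` move the quadrature error from the second variable of
`K` onto `kernelOp Ω K (ζ i) = lam i * ζ i`. -/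
theorem pairing_errorFunction (hΩ : IsOpen Ω) (hΩb : Bornology.IsBounded Ω)
    (hK : IsAdmissibleKernel Ω K) (hM : IsMercerDecomposition Ω K lam ζ)
    {N : ℕ} {y : Fin N → EuclideanSpace ℝ (Fin D)} (hy : ∀ n, y n ∈ Ω) (i : ℕ) :
    pairing Ω (errorFunction Ω K y) (ζ i) = lam i * quadError Ω y (ζ i) := by
  have := isFiniteMeasure_restrict_of_isBounded hΩb
  have hζ := hM.integrable hΩb i
  obtain ⟨C, hC⟩ := hK.bounded
  have hmeas : MeasurableSet (Ω ×ˢ Ω) := hΩ.measurableSet.prod hΩ.measurableSet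
  have hprod : Integrable (fun z : EuclideanSpace ℝ (Fin D) × EuclideanSpace ℝ (Fin D) =>
      K z.1 z.2 * ζ i z.1) ((volume.restrict Ω).prod (volume.restrict Ω)) := by
    refine (hζ.comp_fst (volume.restrict Ω)).bdd_mul (c := C) ?_ ?_
    · rw [Measure.prod_restrict]
      exact hK.continuousOn.aestronglyMeasurable hmeas
    · rw [Measure.prod_restrict]
      filter_upwards [ae_restrict_mem hmeas] with z hz using hC _ hz.1 _ hz.2
  have hsec : ∀ z ∈ Ω, ∫ x in Ω, K x z * ζ i x = lam i * ζ i z := fun z hz => by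
    rw [← hM.eigen i z hz, kernelOp]
    exact setIntegral_congr_fun hΩ.measurableSet fun x hx => by simp only [hK.symm x hx z hz]
  have hint : ∀ z ∈ Ω, Integrable (fun x => K x z * ζ i x) (volume.restrict Ω) := fun z hz => by
    refine hζ.bdd_mul (c := C) ?_ ?_
    · refine ContinuousOn.aestronglyMeasurable ?_ hΩ.measurableSet
      exact hK.continuousOn.comp (f := fun x => (x, z)) (by fun_prop) fun x hx => ⟨hx, hz⟩
    · filter_upwards [ae_restrict_mem hΩ.measurableSet] with x hx using hC _ hx _ hz
  have hfub : ∫ x in Ω, (∫ z in Ω, K x z) * ζ i x = lam i * ∫ z in Ω, ζ i z := by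
    simp_rw [← integral_mul_const]
    rw [integral_integral_swap hprod, ← integral_const_mul]
    exact setIntegral_congr_fun hΩ.measurableSet hsec
  have hfst : Integrable (fun x => (∫ z in Ω, K x z) * ζ i x) (volume.restrict Ω) := by
    simp_rw [← integral_mul_const]
    exact hprod.integral_prod_left
  simp only [pairing, errorFunction, quadError, sub_mul, mul_assoc, Finset.sum_mul]
  rw [integral_sub hfst ((integrable_finsetSum _ fun n _ => hint _ (hy n)).const_mul _), hfub,
    integral_const_mul, integral_finsetSum _ fun n _ => hint _ (hy n)]
  simp only [hsec _ (hy _), ← Finset.mul_sum]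
  ring

theorem spectralError_eq_mercerNorm_errorFunction (hΩ : IsOpen Ω) (hΩb : Bornology.IsBounded Ω)
    (hK : IsAdmissibleKernel Ω K) (hM : IsMercerDecomposition Ω K lam ζ) (s : ℝ) (q : ℝ≥0∞)
    {N : ℕ} {y : Fin N → EuclideanSpace ℝ (Fin D)} (hy : ∀ n, y n ∈ Ω) :
    spectralError Ω lam ζ s q y = mercerNorm Ω lam ζ (2 - s) q (errorFunction Ω K y) := by
  rw [spectralError, mercerNorm]
  congr 1
  ext i
  rw [pairing_errorFunction hΩ hΩb hK hM hy, ← mul_assoc, ← Real.rpow_add_one (hM.pos i).ne']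
  ring_nf

/-! ### The error bound for a convergent Mercer series -/

theorem quadError_mercerSum (hΩb : Bornology.IsBounded Ω) (hM : IsMercerDecomposition Ω K lam ζ)
    {N : ℕ} (y : Fin N → EuclideanSpace ℝ (Fin D)) (m : ℕ) :
    quadError Ω y (mercerSum Ω ζ φ m)
      = ∑ i ∈ Finset.range m, pairing Ω φ (ζ i) * quadError Ω y (ζ i) := by
  simp only [quadError, mercerSum]
  rw [integral_finsetSum _ fun i _ => (hM.integrable hΩb i).const_mul _, Finset.sum_comm]
  simp only [integral_const_mul, ← Finset.mul_sum, mul_sub, Finset.sum_sub_distrib]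
  congr 1
  rw [Finset.mul_sum]
  exact Finset.sum_congr rfl fun i _ => by ring

theorem tendsto_integral_mercerSum (hΩb : Bornology.IsBounded Ω)
    (hM : IsMercerDecomposition Ω K lam ζ) (hφ : Integrable φ (volume.restrict Ω))
    (hlim : Tendsto (fun m => eLpNorm (fun x => φ x - mercerSum Ω ζ φ m x) 2 (volume.restrict Ω))
      atTop (𝓝 0)) :
    Tendsto (fun m => ∫ x in Ω, mercerSum Ω ζ φ m x) atTop (𝓝 (∫ x in Ω, φ x)) := by
  have := isFiniteMeasure_restrict_of_isBounded hΩb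
  have hS : ∀ m, Integrable (mercerSum Ω ζ φ m) (volume.restrict Ω) := fun m =>
    integrable_finsetSum _ fun i _ => (hM.integrable hΩb i).const_mul _
  refine tendsto_integral_of_L1' φ hφ.aestronglyMeasurable (Eventually.of_forall hS) ?_
  have hconst : (volume.restrict Ω) univ ^ (1 / (1 : ℝ≥0∞).toReal - 1 / (2 : ℝ≥0∞).toReal) ≠ ∞ :=
    ENNReal.rpow_ne_top_of_nonneg (by norm_num) (measure_ne_top _ _)
  have h2 := ENNReal.Tendsto.mul_const (b := (volume.restrict Ω) univ ^
    (1 / (1 : ℝ≥0∞).toReal - 1 / (2 : ℝ≥0∞).toReal)) hlim (Or.inr hconst)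
  rw [zero_mul] at h2
  refine tendsto_of_tendsto_of_tendsto_of_le_of_le tendsto_const_nhds h2 (fun _ => zero_le)
    fun m => ?_
  rw [eLpNorm_sub_comm]
  exact eLpNorm_le_eLpNorm_mul_rpow_measure_univ one_le_two
    (hφ.aestronglyMeasurable.sub (hS m).aestronglyMeasurable)

/-- The quadrature error is continuous along the Mercer series of `φ`, in the integral by `L²`
convergence and at the nodes by hypothesis; Hölder's inequality bounds it on every partial sum. -/
theorem quadError_le_of_tendsto_mercerSum (hΩb : Bornology.IsBounded Ω)
    (hM : IsMercerDecomposition Ω K lam ζ) {s : ℝ} {p q : ℝ≥0∞} (hp : 1 ≤ p)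
    (hpq : p⁻¹ + q⁻¹ = 1) {N : ℕ} {y : Fin N → EuclideanSpace ℝ (Fin D)}
    (hφ : MemMercerSpace Ω lam ζ s p φ)
    (hnodes : ∀ n, Tendsto (fun m => mercerSum Ω ζ φ m (y n)) atTop (𝓝 (φ (y n)))) :
    ENNReal.ofReal |quadError Ω y φ|
      ≤ spectralError Ω lam ζ s q y * mercerNorm Ω lam ζ s p φ := by
  have := isFiniteMeasure_restrict_of_isBounded hΩb
  have hlim : Tendsto (fun m => quadError Ω y (mercerSum Ω ζ φ m)) atTop (𝓝 (quadError Ω y φ)) :=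
    (tendsto_integral_mercerSum hΩb hM (hφ.memLp.integrable hp) hφ.mercer).sub
      ((tendsto_finsetSum _ fun n _ => hnodes n).const_mul _)
  refine le_of_tendsto (ENNReal.tendsto_ofReal hlim.abs) (Eventually.of_forall fun m => ?_)
  rw [quadError_mercerSum hΩb hM]
  refine le_trans (le_of_eq ?_) (ofReal_abs_sum_mul_le_seqNorm hpq _ _ (Finset.range m))
  congr 2
  refine Finset.sum_congr rfl fun i _ => ?_
  linear_combination (-(pairing Ω φ (ζ i) * quadError Ω y (ζ i))) * hM.rpow_neg_half_mul_rpow_half s i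

/-! ### Pointwise convergence of the Mercer series -/

/-- Near a point where evaluation is bounded, the Mercer series converges locally uniformly. Its
sum is continuous there and agrees with `φ` almost everywhere, hence everywhere if `φ` is
continuous. -/
theorem tendsto_mercerSum_of_locally_bounded (hΩ : IsOpen Ω)
    (hM : IsMercerDecomposition Ω K lam ζ) {s : ℝ} {p q : ℝ≥0∞} (hp : 1 ≤ p) (hp_top : p ≠ ∞)
    (hpq : p⁻¹ + q⁻¹ = 1) (hφ : ContinuousOn φ Ω)
    (hlim : Tendsto (fun m => eLpNorm (fun x => φ x - mercerSum Ω ζ φ m x) 2 (volume.restrict Ω))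
      atTop (𝓝 0))
    (hnorm : mercerNorm Ω lam ζ s p φ < ∞)
    {x₀ : EuclideanSpace ℝ (Fin D)} (hx₀ : x₀ ∈ Ω) {C : ℝ≥0}
    (hC : ∀ᶠ x in 𝓝 x₀, seqNorm q (fun i => lam i ^ (s / 2) * ζ i x) ≤ C) :
    Tendsto (fun m => mercerSum Ω ζ φ m x₀) atTop (𝓝 (φ x₀)) := by
  obtain ⟨U, hU, hUo, hxU⟩ := eventually_nhds_iff.mp (hC.and (hΩ.mem_nhds hx₀))
  have hUΩ : U ⊆ Ω := fun x hx => (hU x hx).2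
  set a : ℕ → ℝ := fun i => lam i ^ (-s / 2) * pairing Ω φ (ζ i) with ha
  have hcont : ∀ m, ContinuousOn (mercerSum Ω ζ φ m) Ω := fun m =>
    continuousOn_finsetSum _ fun i _ => (hM.continuousOn i).const_mul _
  have hblock : ∀ x ∈ U, ∀ m k, m ≤ k →
      ENNReal.ofReal |mercerSum Ω ζ φ k x - mercerSum Ω ζ φ m x|
        ≤ C * seqNorm p (indicator (Ici m) a) := fun x hx m k hmk => by
    refine le_trans (le_of_eq ?_) ((ofReal_abs_sum_mul_le_seqNorm hpq (indicator (Ici m) a)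
      (fun i => lam i ^ (s / 2) * ζ i x) (Finset.Ico m k)).trans
      (mul_le_mul_left (hU x hx).1 _))
    rw [mercerSum, mercerSum, ← Finset.sum_Ico_eq_sub _ hmk]
    congr 2
    refine Finset.sum_congr rfl fun i hi => ?_
    rw [indicator_of_mem (show i ∈ Ici m from (Finset.mem_Ico.mp hi).1)]
    linear_combination (-(pairing Ω φ (ζ i) * ζ i x)) * hM.rpow_neg_half_mul_rpow_half s i
  -- `p < ∞` is what makes the tails of an `ℓ^p` sequence tend to zero
  have htail : Tendsto (fun m => C * seqNorm p (indicator (Ici m) a)) atTop (𝓝 0) := by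
    simpa using ENNReal.Tendsto.const_mul (a := (C : ℝ≥0∞))
      (tendsto_seqNorm_tail (zero_lt_one.trans_le hp).ne' hp_top hnorm)
      (Or.inr ENNReal.coe_ne_top)
  have hcauchy : UniformCauchySeqOn (mercerSum Ω ζ φ) atTop U := by
    rw [Metric.uniformCauchySeqOn_iff]
    intro ε hε
    obtain ⟨M, hM'⟩ := eventually_atTop.mp
      (htail.eventually (gt_mem_nhds (ENNReal.ofReal_pos.mpr hε)))
    have key : ∀ x ∈ U, ∀ m ≥ M, ∀ k ≥ m, |mercerSum Ω ζ φ k x - mercerSum Ω ζ φ m x| < ε :=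
      fun x hx m hm k hk => (ENNReal.ofReal_lt_ofReal_iff hε).mp
        ((hblock x hx m k hk).trans_lt (hM' m hm))
    refine ⟨M, fun m hm k hk x hx => ?_⟩
    rw [Real.dist_eq]
    rcases le_total m k with h | h
    · rw [abs_sub_comm]; exact key x hx m hm k h
    · exact key x hx k hk m h
  have hex : ∀ x, ∃ t, x ∈ U → Tendsto (fun m => mercerSum Ω ζ φ m x) atTop (𝓝 t) := fun x => by
    by_cases hx : x ∈ U
    · obtain ⟨t, ht⟩ := cauchySeq_tendsto_of_complete (hcauchy.cauchySeq hx)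
      exact ⟨t, fun _ => ht⟩
    · exact ⟨0, fun h => absurd h hx⟩
  choose g hg using hex
  have hunif : TendstoUniformlyOn (mercerSum Ω ζ φ) g atTop U :=
    hcauchy.tendstoUniformlyOn_of_tendsto hg
  have hgc : ContinuousOn g U :=
    hunif.continuousOn (Frequently.of_forall fun m => (hcont m).mono hUΩ)
  -- `L²` convergence identifies `g` with `φ`, almost everywhere along a subsequence
  have hmeas : TendstoInMeasure (volume.restrict Ω) (mercerSum Ω ζ φ) atTop φ := by
    refine tendstoInMeasure_of_tendsto_eLpNorm two_ne_zero
      (fun m => (hcont m).aestronglyMeasurable hΩ.measurableSet)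
      (hφ.aestronglyMeasurable hΩ.measurableSet) (hlim.congr fun m => ?_)
    rw [eLpNorm_sub_comm]
    rfl
  obtain ⟨ns, hns, hae⟩ := hmeas.exists_seq_tendsto_ae
  have hae' : φ =ᵐ[volume.restrict U] g := by
    filter_upwards [ae_restrict_of_ae_restrict_of_subset hUΩ hae,
      ae_restrict_mem hUo.measurableSet] with x hx hxU
    exact tendsto_nhds_unique hx ((hg x hxU).comp hns.tendsto_atTop)
  have heq := Measure.eqOn_open_of_ae_eq hae' hUo (hφ.mono hUΩ) hgc hxU
  rw [heq]
  exact hg x₀ hxU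

/-- Point evaluation is bounded, uniformly on `Ω`, in the reproducing kernel Hilbert space, which is
the case `s = 1`, `p = 2`. -/
theorem IsMercerDecomposition.seqNorm_two_le (hΩ : IsOpen Ω) (hΩb : Bornology.IsBounded Ω)
    (hK : IsAdmissibleKernel Ω K) (hM : IsMercerDecomposition Ω K lam ζ) :
    ∃ C : ℝ≥0, ∀ x ∈ Ω, seqNorm 2 (fun i => lam i ^ ((1 : ℝ) / 2) * ζ i x) ≤ C := by
  obtain ⟨C, hC⟩ := hK.bounded
  refine ⟨(ENNReal.ofReal C ^ ((1 : ℝ) / 2)).toNNReal, fun x hx => ?_⟩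
  rw [ENNReal.coe_toNNReal (ENNReal.rpow_ne_top_of_nonneg (by norm_num) ENNReal.ofReal_ne_top),
    seqNorm_eq_tsum two_ne_zero ENNReal.ofNat_ne_top]
  simp only [ENNReal.toReal_ofNat]
  gcongr
  rw [ENNReal.tsum_eq_iSup_sum]
  refine iSup_le fun F => ?_
  have hterm : ∀ i, ENNReal.ofReal |lam i ^ ((1 : ℝ) / 2) * ζ i x| ^ (2 : ℝ)
      = ENNReal.ofReal (lam i * ζ i x ^ 2) := fun i => by
    rw [ENNReal.rpow_two, ← ENNReal.ofReal_pow (abs_nonneg _), sq_abs, mul_pow,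
      ← Real.sqrt_eq_rpow, Real.sq_sqrt (hM.pos i).le]
  simp_rw [hterm]
  rw [← ENNReal.ofReal_sum_of_nonneg fun i _ => mul_nonneg (hM.pos i).le (sq_nonneg _)]
  exact ENNReal.ofReal_le_ofReal ((hM.sum_le_diagonal hΩ hΩb hK F hx).trans
    ((le_abs_self _).trans (hC x hx x hx)))

/-- For `1 ≤ s` and `p ≤ 2`, a function of finite `H_K^{s,p}` norm has finite norm in the
reproducing kernel Hilbert space: `ℓ^p` is contained in `ℓ²`, and the eigenvalues are at most
`lam 0`. -/
theorem mercerNorm_one_two_lt_top (hM : IsMercerDecomposition Ω K lam ζ) {s : ℝ} {p : ℝ≥0∞}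
    (hs : 1 ≤ s) (hp : 1 ≤ p) (hp2 : p ≤ 2) (hφ : mercerNorm Ω lam ζ s p φ < ∞) :
    mercerNorm Ω lam ζ 1 2 φ < ∞ := by
  have hp0 : p ≠ 0 := (zero_lt_one.trans_le hp).ne'
  have hp_top : p ≠ ∞ := (hp2.trans_lt ENNReal.ofNat_lt_top).ne
  rw [mercerNorm, seqNorm_lt_top_iff_memℓp hp0 hp_top] at hφ
  have h2 := (hφ.of_exponent_ge hp2).const_mul (lam 0 ^ ((s - 1) / 2))
  rw [← seqNorm_lt_top_iff_memℓp two_ne_zero ENNReal.ofNat_ne_top] at h2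
  refine (seqNorm_mono fun i => ?_).trans_lt h2
  have hle : lam i ^ (-1 / 2 : ℝ) ≤ lam 0 ^ ((s - 1) / 2) * lam i ^ (-s / 2) := by
    have h : lam i ^ (-1 / 2 : ℝ) = lam i ^ ((s - 1) / 2) * lam i ^ (-s / 2) := by
      rw [← Real.rpow_add (hM.pos i)]; ring_nf
    rw [h]
    have := Real.rpow_le_rpow (hM.pos i).le (hM.antitone (Nat.zero_le i))
      (show 0 ≤ (s - 1) / 2 by linarith)
    have := Real.rpow_nonneg (hM.pos i).le (-s / 2)
    gcongr
  rw [← mul_assoc, abs_mul, abs_mul, abs_of_nonneg (Real.rpow_nonneg (hM.pos i).le _)]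
  exact mul_le_mul_of_nonneg_right (hle.trans (le_abs_self _)) (abs_nonneg _)

end

theorem proposition5p3 {D : ℕ} (Ω : Set (EuclideanSpace ℝ (Fin D)))
    (hΩ : IsOpen Ω) (hΩb : Bornology.IsBounded Ω)
    (K : EuclideanSpace ℝ (Fin D) → EuclideanSpace ℝ (Fin D) → ℝ)
    (hK : IsAdmissibleKernel Ω K)
    (lam : ℕ → ℝ) (ζ : ℕ → EuclideanSpace ℝ (Fin D) → ℝ)
    (hM : IsMercerDecomposition Ω K lam ζ)
    (s : ℝ) (hs : 0 < s)
    (p q : ℝ≥0∞) (hp : 1 ≤ p) (hp_top : p ≠ ∞) (hpq : p⁻¹ + q⁻¹ = 1)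
    (N : ℕ) (hN : 0 < N) (y : Fin N → EuclideanSpace ℝ (Fin D)) (hy : ∀ n, y n ∈ Ω) :
    -- the bound, the values of `φ` at the nodes being those of its Mercer series
    (∀ φ : EuclideanSpace ℝ (Fin D) → ℝ, MemMercerSpace Ω lam ζ s p φ →
      (∀ n, Tendsto (fun m => mercerSum Ω ζ φ m (y n)) atTop (𝓝 (φ (y n)))) →
      ENNReal.ofReal |quadError Ω y φ|
        ≤ spectralError Ω lam ζ s q y * mercerNorm Ω lam ζ s p φ) ∧
    -- the bound for all continuous `φ`, in the ranges where point evaluation is bounded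
    (∀ φ : EuclideanSpace ℝ (Fin D) → ℝ, MemMercerSpace Ω lam ζ s p φ → ContinuousOn φ Ω →
      ((1 ≤ s ∧ p ≤ 2) ∨
        ∀ n, ∃ C : ℝ≥0, ∀ᶠ x in 𝓝 (y n), seqNorm q (fun i => lam i ^ (s / 2) * ζ i x) ≤ C) →
      ENNReal.ofReal |quadError Ω y φ|
        ≤ spectralError Ω lam ζ s q y * mercerNorm Ω lam ζ s p φ) ∧
    -- the error function as a norm of `e_K(Y)`
    spectralError Ω lam ζ s q y = mercerNorm Ω lam ζ (2 - s) q (errorFunction Ω K y) := by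
  refine ⟨fun φ hφ hnodes => quadError_le_of_tendsto_mercerSum hΩb hM hp hpq hφ hnodes,
    fun φ hφ hφc hcase => quadError_le_of_tendsto_mercerSum hΩb hM hp hpq hφ fun n => ?_,
    spectralError_eq_mercerNorm_errorFunction hΩ hΩb hK hM s q hy⟩
  rcases hcase with ⟨hs1, hp2⟩ | hC
  -- Convergence at the nodes does not involve `s`, `p`, `q`, and may be proved for `1`, `2`, `2`.
  · obtain ⟨C, hC⟩ := hM.seqNorm_two_le hΩ hΩb hK
    exact tendsto_mercerSum_of_locally_bounded hΩ hM one_le_two ENNReal.ofNat_ne_top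
      ENNReal.inv_two_add_inv_two hφc hφ.mercer
      (mercerNorm_one_two_lt_top hM hs1 hp hp2 hφ.norm_lt_top) (hy n)
      (eventually_of_mem (hΩ.mem_nhds (hy n)) hC)
  · obtain ⟨C, hC⟩ := hC n
    exact tendsto_mercerSum_of_locally_bounded hΩ hM hp hp_top hpq hφc hφ.mercer
      hφ.norm_lt_top (hy n) hC
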